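/- Let $H$ be a complex Hilbert space (not necessarily separable), let $B(H)$ be the algebra of bounded linear operators on $H$ with the operator norm, and for $S,T\in B(H)$ let $\delta_{S,T}:B(H)\to B(H)$ be the generalized derivation $\delta_{S,T}(X)=SX-XT$. Suppose that the pair $(S,T)$ has the Fuglede--Putnam property: for every $C\in B(H)$, $SC=CT$ implies $S^*C=CT^*$. Then for every $C\in\ker\delta_{S,T}$ (that is, $C\in B(H)$ with $SC=CT$) and every $X\in B(H)$, $$\|\delta_{S,T}(X)+C\|=\|SX-XT+C\|\ \ge\ \|C\|.$$ In other words, the range of $\delta_{S,T}$ is orthogonal to its kernel in the sense of Birkhoff. -/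

import Mathlib

/-- The generalized derivation `δ_{S,T}(X) = S X - X T` on `B(H)`. -/
def genDerivation {H : Type*} [NormedAddCommGroup H] [InnerProductSpace ℂ H]
    (S T : H →L[ℂ] H) : (H →L[ℂ] H) →ₗ[ℂ] (H →L[ℂ] H) where
  toFun X := S * X - X * T
  map_add' X Y := by rw [mul_add, add_mul]; abel
  map_smul' c X := by
    rw [mul_smul_comm, smul_mul_assoc, RingHom.id_apply, smul_sub]

/-- The pair `(S, T)` has the Fuglede-Putnam property: every `C ∈ B(H)` with `S C = C T`
also satisfies `S* C = C T*`. -/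
def HasFugledePutnam {H : Type*} [NormedAddCommGroup H] [InnerProductSpace ℂ H]
    [CompleteSpace H] (S T : H →L[ℂ] H) : Prop :=
  ∀ C : H →L[ℂ] H, S * C = C * T →
    ContinuousLinearMap.adjoint S * C = C * ContinuousLinearMap.adjoint T

/-! For skew-adjoint `a`, `b` the factors `exp (s a)`, `exp (-s b)` are unitary, so averaging `exp
(s a) y exp (-s b)` over `[0, L]` is a contraction. It fixes every intertwiner `c` and sends `a y -
y b` to norm `O(1/L)`; letting `L → ∞` gives the inequality for such a pair. A normal element is a
combination of two commuting skew-adjoint ones, so two successive means give Anderson's inequality.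
In general, the Fuglede-Putnam property for `C` and `S C` makes `S` normal on the closure of the
range of `C`, and `T` normal on `(ker C)ᗮ`. Compressing to these subspaces fixes `C` and does not
increase norms. -/

/-- The mean over `[0, L]` of the orbit `s ↦ exp (s a) y exp (-s b)`. -/
noncomputable def conjMean {A : Type*} [CStarAlgebra A] (L : ℝ) (a b y : A) : A :=
  L⁻¹ • ∫ s in (0 : ℝ)..L, NormedSpace.exp (s • a) * y * NormedSpace.exp (s • (-b))

section Mean

variable {A : Type*} [CStarAlgebra A]

lemma hasDerivAt_exp_mul_mul_exp (a b y : A) (s : ℝ) :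
    HasDerivAt (fun s : ℝ => NormedSpace.exp (s • a) * y * NormedSpace.exp (s • (-b)))
      (NormedSpace.exp (s • a) * (a * y - y * b) * NormedSpace.exp (s • (-b))) s := by
  have h := ((hasDerivAt_exp_smul_const (𝕂 := ℝ) a s).mul_const y).mul
    (hasDerivAt_exp_smul_const' (𝕂 := ℝ) (-b) s)
  refine h.congr_deriv ?_
  noncomm_ring

lemma continuous_exp_mul_mul_exp (a b y : A) :
    Continuous fun s : ℝ => NormedSpace.exp (s • a) * y * NormedSpace.exp (s • (-b)) :=
  continuous_iff_continuousAt.2 fun s => (hasDerivAt_exp_mul_mul_exp a b y s).continuousAt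

lemma norm_exp_smul_le_one {a : A} (ha : a ∈ skewAdjoint A) (s : ℝ) :
    ‖NormedSpace.exp (s • a)‖ ≤ 1 := by
  let _ : NormedAlgebra ℚ A := NormedAlgebra.restrictScalars ℚ ℂ A
  have h := NormedSpace.exp_mem_unitary_of_mem_skewAdjoint (skewAdjoint.smul_mem s ha)
  nontriviality A
  exact (CStarRing.norm_of_mem_unitary h).le

lemma norm_exp_mul_mul_exp_le {a b : A} (ha : a ∈ skewAdjoint A) (hb : b ∈ skewAdjoint A)
    (y : A) (s : ℝ) :
    ‖NormedSpace.exp (s • a) * y * NormedSpace.exp (s • (-b))‖ ≤ ‖y‖ := by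
  calc _ ≤ ‖NormedSpace.exp (s • a)‖ * ‖y‖ * ‖NormedSpace.exp (s • (-b))‖ := norm_mul₃_le
    _ ≤ 1 * ‖y‖ * 1 := by
        gcongr
        · exact norm_exp_smul_le_one ha s
        · exact norm_exp_smul_le_one (neg_mem hb) s
    _ = ‖y‖ := by ring

lemma conjMean_add (L : ℝ) (a b x y : A) :
    conjMean L a b (x + y) = conjMean L a b x + conjMean L a b y := by
  simp only [conjMean, mul_add, add_mul]
  rw [intervalIntegral.integral_add
    ((continuous_exp_mul_mul_exp a b x).intervalIntegrable _ _)
    ((continuous_exp_mul_mul_exp a b y).intervalIntegrable _ _), smul_add]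

lemma norm_conjMean_le {L : ℝ} (hL : 0 < L) {a b : A} (ha : a ∈ skewAdjoint A)
    (hb : b ∈ skewAdjoint A) (y : A) : ‖conjMean L a b y‖ ≤ ‖y‖ := by
  have h := intervalIntegral.norm_integral_le_of_norm_le_const (a := 0) (b := L)
    fun s _ => norm_exp_mul_mul_exp_le ha hb y s
  rw [conjMean, norm_smul, norm_inv, Real.norm_of_nonneg hL.le, inv_mul_le_iff₀ hL]
  simpa [abs_of_pos hL, mul_comm] using h

/-- The integrand is the derivative of the orbit of `y`, so only the two endpoint values survive,
each of norm at most `‖y‖`. -/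
lemma norm_conjMean_commutator_le {L : ℝ} (hL : 0 < L) {a b : A} (ha : a ∈ skewAdjoint A)
    (hb : b ∈ skewAdjoint A) (y : A) :
    ‖conjMean L a b (a * y - y * b)‖ ≤ L⁻¹ * (2 * ‖y‖) := by
  rw [conjMean, intervalIntegral.integral_eq_sub_of_hasDerivAt
    (fun s _ => hasDerivAt_exp_mul_mul_exp a b y s)
    ((continuous_exp_mul_mul_exp a b _).intervalIntegrable _ _), norm_smul, norm_inv,
    Real.norm_of_nonneg hL.le]
  gcongr
  refine (norm_sub_le _ _).trans ?_
  have h₁ := norm_exp_mul_mul_exp_le ha hb y L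
  have h₂ := norm_exp_mul_mul_exp_le ha hb y 0
  linarith

lemma conjMean_of_intertwines {L : ℝ} (hL : 0 < L) {a b c : A} (h : a * c = c * b) :
    conjMean L a b c = c := by
  let _ : NormedAlgebra ℚ A := NormedAlgebra.restrictScalars ℚ ℂ A
  have hs (s : ℝ) : NormedSpace.exp (s • a) * c * NormedSpace.exp (s • (-b)) = c := by
    have h₁ : SemiconjBy c (s • b) (s • a) := by
      simp only [SemiconjBy, mul_smul_comm, smul_mul_assoc, h]
    have h₂ : SemiconjBy c (NormedSpace.exp (s • b)) (NormedSpace.exp (s • a)) := h₁.exp_right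
    rw [← h₂.eq, mul_assoc, ← NormedSpace.exp_add_of_commute, ← smul_add, add_neg_cancel,
      smul_zero, NormedSpace.exp_zero, mul_one]
    exact ((Commute.refl b).neg_right.smul_left s).smul_right s
  simp only [conjMean, hs, intervalIntegral.integral_const, sub_zero]
  rw [smul_smul, inv_mul_cancel₀ hL.ne', one_smul]

/-- This lets the mean along one commuting pair pass through the commutator that the other mean is
to kill. -/
lemma conjMean_commutator {a b u v : A} (hu : Commute u a) (hv : Commute v b) (L : ℝ) (y : A) :
    conjMean L a b (u * y - y * v) = u * conjMean L a b y - conjMean L a b y * v := by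
  have hi := (continuous_exp_mul_mul_exp a b y).intervalIntegrable (μ := MeasureTheory.volume) 0 L
  simp only [conjMean, mul_smul_comm, smul_mul_assoc]
  have hl := (ContinuousLinearMap.mul ℝ A u).intervalIntegral_comp_comm hi
  have hr := ((ContinuousLinearMap.mul ℝ A).flip v).intervalIntegral_comp_comm hi
  simp only [ContinuousLinearMap.flip_apply, ContinuousLinearMap.mul_apply'] at hl hr
  rw [← smul_sub, ← hl, ← hr, ← intervalIntegral.integral_sub]
  · congr 2
    ext s
    have h₁ : u * NormedSpace.exp (s • a) = NormedSpace.exp (s • a) * u :=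
      (hu.smul_right s).exp_right
    have h₂ : v * NormedSpace.exp (s • (-b)) = NormedSpace.exp (s • (-b)) * v :=
      (hv.neg_right.smul_right s).exp_right
    simp only [mul_sub, sub_mul, mul_assoc, ← h₂]
    simp only [← mul_assoc, h₁]
  · exact (continuous_const.mul (continuous_exp_mul_mul_exp a b y)).intervalIntegrable _ _
  · exact ((continuous_exp_mul_mul_exp a b y).mul continuous_const).intervalIntegrable _ _

theorem norm_le_norm_add_commutators {a b a' b' : A} (ha : a ∈ skewAdjoint A)
    (hb : b ∈ skewAdjoint A) (ha' : a' ∈ skewAdjoint A) (hb' : b' ∈ skewAdjoint A)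
    (hab : Commute a b) (hab' : Commute a' b') {c : A} (hac : a * c = c * a')
    (hbc : b * c = c * b') (x y : A) :
    ‖c‖ ≤ ‖(a * x - x * a') + (b * y - y * b') + c‖ := by
  have key (L : ℝ) (hL : 0 < L) :
      ‖c‖ ≤ ‖(a * x - x * a') + (b * y - y * b') + c‖ + L⁻¹ * (2 * ‖x‖ + 2 * ‖y‖) := by
    set z := (a * x - x * a') + (b * y - y * b') + c with hz
    have h : conjMean L b b' (conjMean L a a' z) =
        conjMean L b b' (conjMean L a a' (a * x - x * a')) +
          conjMean L b b' (b * conjMean L a a' y - conjMean L a a' y * b') + c := by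
      rw [hz, conjMean_add, conjMean_add, conjMean_of_intertwines hL hac, conjMean_add,
        conjMean_add, conjMean_of_intertwines hL hbc, conjMean_commutator hab.symm hab'.symm]
    have h₁ := (norm_conjMean_le hL hb hb' (conjMean L a a' (a * x - x * a'))).trans
      (norm_conjMean_commutator_le hL ha ha' x)
    have h₂ : ‖conjMean L b b' (b * conjMean L a a' y - conjMean L a a' y * b')‖ ≤
        L⁻¹ * (2 * ‖y‖) := (norm_conjMean_commutator_le hL hb hb' _).trans (by
      gcongr
      exact norm_conjMean_le hL ha ha' y)
    have h₃ := (norm_conjMean_le hL hb hb' (conjMean L a a' z)).trans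
      (norm_conjMean_le hL ha ha' z)
    rw [← sub_eq_iff_eq_add'] at h
    rw [← h]
    refine (norm_sub_le _ _).trans ?_
    have h₄ := norm_add_le (conjMean L b b' (conjMean L a a' (a * x - x * a')))
      (conjMean L b b' (b * conjMean L a a' y - conjMean L a a' y * b'))
    linarith
  refine ge_of_tendsto (x := (Filter.atTop : Filter ℝ)) ?_ ((Filter.eventually_gt_atTop 0).mono key)
  simpa using (tendsto_inv_atTop_zero (𝕜 := ℝ)).mul_const (2 * ‖x‖ + 2 * ‖y‖) |>.const_add
    ‖(a * x - x * a') + (b * y - y * b') + c‖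

/-- Anderson's inequality for a pair of normal elements. -/
theorem norm_le_norm_commutator_add_of_isStarNormal {m n c : A} (hm : IsStarNormal m)
    (hn : IsStarNormal n) (h : m * c = c * n) (h' : star m * c = c * star n) (x : A) :
    ‖c‖ ≤ ‖m * x - x * n + c‖ := by
  have hsk (k : A) : k - star k ∈ skewAdjoint A := by
    simp [skewAdjoint.mem_iff]
  have hsk' (k : A) : Complex.I • (k + star k) ∈ skewAdjoint A := by
    simp [skewAdjoint.mem_iff, add_comm]
  have hcomm {k : A} (hk : IsStarNormal k) :
      Commute (k - star k) (Complex.I • (k + star k)) := by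
    refine Commute.smul_right ?_ _
    have := hk.star_comm_self
    exact ((Commute.refl k).add_right this.symm).sub_left (this.add_right (Commute.refl _))
  -- With `a = m - m*` and `b = i (m + m*)`, `m = a / 2 - (i / 2) b`, and likewise for `n`; these
  -- coefficients are moved onto `x`.
  have key := norm_le_norm_add_commutators (hsk m) (hsk' m) (hsk n) (hsk' n) (hcomm hm)
    (hcomm hn) (c := c) (by rw [sub_mul, mul_sub, h, h'])
    (by rw [smul_mul_assoc, mul_smul_comm, add_mul, mul_add, h, h'])
    ((2⁻¹ : ℂ) • x) ((-(Complex.I * 2⁻¹)) • x)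
  convert key using 3
  have hI : -(Complex.I * 2⁻¹) * Complex.I = 2⁻¹ := by
    linear_combination (-(2⁻¹ : ℂ)) * Complex.I_mul_I
  have hI' : Complex.I * -(Complex.I * 2⁻¹) = 2⁻¹ := by rw [mul_comm, hI]
  simp only [mul_smul_comm, smul_mul_assoc, smul_smul, hI, hI']
  simp only [sub_mul, add_mul, mul_sub, mul_add]
  module

end Mean

section Reduction

variable {H : Type*} [NormedAddCommGroup H] [InnerProductSpace ℂ H] [CompleteSpace H]

/-- An operator such that it and its adjoint leave `K` invariant commutes with the projection. -/
lemma commute_starProjection_of_invariant (K : Submodule ℂ H) [K.HasOrthogonalProjection]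
    (S : H →L[ℂ] H) (h : ∀ x ∈ K, S x ∈ K) (h' : ∀ x ∈ K, star S x ∈ K) :
    Commute S K.starProjection := by
  ext x
  have hx : S x = S (K.starProjection x) + S (x - K.starProjection x) := by
    rw [← map_add, add_sub_cancel]
  have h₁ : S (x - K.starProjection x) ∈ Kᗮ := by
    intro u hu
    rw [← ContinuousLinearMap.adjoint_inner_left]
    exact K.sub_starProjection_mem_orthogonal x _ (h' u hu)
  simp only [mul_apply_eq_comp, hx, map_add]
  rw [Submodule.starProjection_eq_self_iff.2 (h _ (K.starProjection_apply_mem x)),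
    (K.starProjection_apply_eq_zero_iff).2 h₁, add_zero]

/-- Range and kernel of an intertwiner reduce the two operators, and there they are normal. -/
lemma norm_le_norm_commutator_add_of_fugledePutnam (S T : H →L[ℂ] H)
    (hST : HasFugledePutnam S T) {C : H →L[ℂ] H} (hC : S * C = C * T) (X : H →L[ℂ] H) :
    ‖C‖ ≤ ‖S * X - X * T + C‖ := by
  have hC' : star S * C = C * star T := hST C hC
  -- `S C` is again an intertwiner, so the hypothesis applies to it as well.
  have hSS : star S * S * C = S * star S * C := by
    have h : star S * (S * C) = S * C * star T := hST (S * C) (by rw [mul_assoc, hC])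
    rw [mul_assoc, h, mul_assoc, ← hC', mul_assoc]
  have hTT : C * (star T * T) = C * (T * star T) := by
    rw [← mul_assoc, ← hC', mul_assoc, ← hC, ← mul_assoc, hSS, mul_assoc, hC', ← mul_assoc, hC,
      mul_assoc]
  let K := C.range.topologicalClosure
  let N := C.ker
  have hcl : IsClosed (N : Set H) := C.isClosed_ker
  have : CompleteSpace N := hcl.completeSpace_coe
  have : CompleteSpace K := C.range.isClosed_topologicalClosure.completeSpace_coe
  let P := K.starProjection
  let Q := Nᗮ.starProjection
  have hPs : star P = P := isSelfAdjoint_starProjection K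
  have hQs : star Q = Q := isSelfAdjoint_starProjection _
  have hPP : P * P = P := K.isIdempotentElem_starProjection
  have hQQ : Q * Q = Q := Nᗮ.isIdempotentElem_starProjection
  have hrange {R R' : H →L[ℂ] H} (h : R * C = C * R') (x : H) (hx : x ∈ K) : R x ∈ K := by
    have hmap : Set.MapsTo R (C.range : Set H) (C.range : Set H) := by
      rintro _ ⟨y, rfl⟩
      exact ⟨R' y, (congr($h y)).symm⟩
    exact hmap.closure R.continuous hx
  have hker {R R' : H →L[ℂ] H} (h : R * C = C * R') (x : H) (hx : x ∈ N) : R' x ∈ N := by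
    have hx' : C x = 0 := hx
    change C (R' x) = 0
    have := congr($h x)
    simp only [mul_apply_eq_comp, hx', map_zero] at this
    exact this.symm
  have hPC : P * C = C := by
    ext x
    exact Submodule.starProjection_eq_self_iff.2 (subset_closure ⟨x, rfl⟩)
  have hQ : Q = 1 - N.starProjection := Submodule.starProjection_orthogonal' N
  have hCN : C * N.starProjection = 0 := by
    ext x
    exact N.starProjection_apply_mem x
  have hCQ : C * Q = C := by rw [hQ, mul_sub, hCN, mul_one, sub_zero]
  have hSP : S * P = P * S := commute_starProjection_of_invariant K S (hrange hC) (hrange hC')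
  have hTQ : T * Q = Q * T := by
    have : Commute T N.starProjection :=
      commute_starProjection_of_invariant N T (hker hC) (hker hC')
    rw [hQ]
    exact (Commute.one_right T).sub_right this
  have hSP' : star S * P = P * star S := by
    have := congr(star $hSP)
    rw [star_mul, star_mul, hPs] at this
    exact this.symm
  have hTQ' : star T * Q = Q * star T := by
    have := congr(star $hTQ)
    rw [star_mul, star_mul, hQs] at this
    exact this.symm
  have hSPn : (star S * S - S * star S) * P = 0 := by
    have h0 : (star S * S - S * star S) * C = 0 := by rw [sub_mul, hSS, sub_self]
    ext x
    have hle : K ≤ (star S * S - S * star S).ker :=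
      Submodule.topologicalClosure_minimal _ (by
        rintro _ ⟨y, rfl⟩
        exact congr($h0 y)) (star S * S - S * star S).isClosed_ker
    exact hle (K.starProjection_apply_mem x)
  -- `T* T - T T*` maps into `ker C`, which `Q` annihilates.
  have hTQn : Q * (star T * T - T * star T) = 0 := by
    have h0 : C * (star T * T - T * star T) = 0 := by rw [mul_sub, hTT, sub_self]
    ext x
    exact (Submodule.starProjection_apply_eq_zero_iff _).2
      (N.le_orthogonal_orthogonal (show C _ = 0 from congr($h0 x)))
  have hm : IsStarNormal (S * P) := ⟨by
    change star (S * P) * (S * P) = S * P * star (S * P)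
    rw [star_mul, hPs]
    rw [sub_mul, sub_eq_zero] at hSPn
    calc P * star S * (S * P) = P * (star S * S * P) := by noncomm_ring
      _ = P * S * (star S * P) := by rw [hSPn]; noncomm_ring
      _ = S * P * (P * star S) := by rw [hSP, hSP']⟩
  have hn : IsStarNormal (Q * T) := ⟨by
    change star (Q * T) * (Q * T) = Q * T * star (Q * T)
    rw [star_mul, hQs]
    rw [mul_sub, sub_eq_zero] at hTQn
    calc star T * Q * (Q * T) = Q * (star T * T) * Q := by
          rw [hTQ', ← hTQ]; noncomm_ring
      _ = Q * T * (star T * Q) := by rw [hTQn]; noncomm_ring⟩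
  have key := norm_le_norm_commutator_add_of_isStarNormal hm hn (c := C)
    (by rw [mul_assoc, hPC, ← mul_assoc, hCQ, hC])
    (by rw [star_mul, star_mul, hPs, hQs, ← hSP', hTQ', mul_assoc, hPC, ← mul_assoc, hCQ, hC'])
    (P * X * Q)
  -- Since `P` commutes with `S` and `Q` with `T`, the commutator for the normal pair `S P`, `Q T`
  -- at `P X Q` is the compression of the original one.
  have hcompress : S * P * (P * X * Q) - P * X * Q * (Q * T) + C =
      P * (S * X - X * T + C) * Q := by
    have h₁ : S * P * (P * X * Q) = P * (S * X) * Q := by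
      calc _ = S * (P * P) * X * Q := by noncomm_ring
        _ = _ := by rw [hPP, hSP]; noncomm_ring
    have h₂ : P * X * Q * (Q * T) = P * (X * T) * Q := by
      calc _ = P * X * ((Q * Q) * T) := by noncomm_ring
        _ = _ := by rw [hQQ, ← hTQ]; noncomm_ring
    rw [h₁, h₂, mul_add, add_mul, hPC, hCQ, mul_sub, sub_mul]
  rw [hcompress] at key
  calc ‖C‖ ≤ ‖P * (S * X - X * T + C) * Q‖ := key
    _ ≤ ‖P‖ * ‖S * X - X * T + C‖ * ‖Q‖ := norm_mul₃_le
    _ ≤ 1 * ‖S * X - X * T + C‖ * 1 := by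
        gcongr
        · exact K.starProjection_norm_le
        · exact Nᗮ.starProjection_norm_le
    _ = ‖S * X - X * T + C‖ := by ring

end Reduction

theorem mainTheorem2 {H : Type*} [NormedAddCommGroup H] [InnerProductSpace ℂ H]
    [CompleteSpace H] (S T : H →L[ℂ] H) (hST : HasFugledePutnam S T)
    (C : H →L[ℂ] H) (hC : C ∈ LinearMap.ker (genDerivation S T)) (X : H →L[ℂ] H) :
    ‖C‖ ≤ ‖genDerivation S T X + C‖ :=
  norm_le_norm_commutator_add_of_fugledePutnam S T hST (sub_eq_zero.1 hC) X
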